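/- Let $\mathbb X\subset\mathbb R^{n_x}$ and $\mathbb U\subset\mathbb R^{n_u}$ be compact, $\mathbb Z=\mathbb X\times\mathbb U$, and let $\mathsf f:\mathbb Z\to\mathbb X$ be continuous (for example a control-affine system $\mathsf f(x,u)=f(x)+\sum_j g_j(x)u_j$ with continuously differentiable right-hand side). Let $\mu'$ and $\nu$ be finite Borel measures on $\mathbb X$ and $\mathbb Z$, and assume that the control Koopman operator $\mathcal G:L^2_{\mu'}(\mathbb X)\to L^2_\nu(\mathbb Z)$, $\mathcal G y=y\circ\mathsf f$, is bounded: there is $L\ge 0$ with $\|y\circ\mathsf f\|_{L^2_\nu}\le L\|y\|_{L^2_{\mu'}}$ for all $y\in L^2_{\mu'}$. Let $\mathcal H_X$ and $\mathcal H_U$ be reproducing kernel Hilbert spaces (RKHSs) of real functions on $\mathbb X$ and $\mathbb U$ with kernels $k_X$ and $k_U$, and let $\mathcal H_Z=\mathcal H_X\oplus(\mathcal H_U\otimes\mathcal H_X)$, with $\otimes$ the Hilbert space tensor product, be regarded as an RKHS of functions on $\mathbb Z$ through the feature map $(x,u)\mapsto(\phi_X(x),\,\phi_U(u)\otimes\phi_X(x))$,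 where $\phi_X(x)=k_X(\cdot,x)$ and $\phi_U(u)=k_U(\cdot,u)$; i.e. $\mathcal H_Z$ is the RKHS with kernel $k_Z((x,u),(x',u'))=k_X(x,x')\,(1+k_U(u,u'))$. Assume that $\mathcal H_X$ and $\mathcal H_Z$ are separable and that $k_X$ and $k_Z$ are continuous and, respectively, $\mu'$- and $\nu$-a.e. bounded. Let $S_{\mu'}:\mathcal H_X\to L^2_{\mu'}$ and $S_\nu:\mathcal H_Z\to L^2_\nu$ be the inclusions $h\mapsto[h]$, and let $P_{\mathcal H_Z}$ be the orthogonal projector of $L^2_\nu$ onto the closure of the range of $S_\nu$. For a bounded operator $G:\mathcal H_X\to\mathcal H_Z$ define the operator norm error and the representation bias by $$E(G)=\|\mathcal G S_{\mu'}-S_\nu G\|_{\mathcal H_X\to L^2_\nu},\qquad B=\|(I-P_{\mathcal H_Z})\,\mathcal G S_{\mu'}\|_{\mathcal H_X\to L^2_\nu}.$$ Then: 1. For every $\delta>0$ there is a finite-rank Hilbert–Schmidt operator $G:\mathcal H_X\to\mathcal H_Z$ with $E(G)<B+\delta$. 2. For every $\delta>0$ there is a finite-rank Hilbert–Schmidt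 operator $G:\mathcal H_X\to\mathcal H_Z$ with $E(G)<\delta$, if and only if $B=0$. Moreover, $B=0$ whenever $\mathcal H_X$ and $\mathcal H_U$ are $C_0$-universal (each consists of $C_0$ functions and is dense in the space of $C_0$ functions on its domain for the supremum norm). -/

import Mathlib

open MeasureTheory
open scoped NNReal ENNReal TensorProduct

namespace ControlKoopman

noncomputable section

/-! ### Real-valued reproducing kernel Hilbert spaces -/

section Kernels

variable {X : Type*} (H : Type*) [NormedAddCommGroup H] [InnerProductSpace ℝ H]
  [CompleteSpace H] [RKHS ℝ H X ℝ]

/-- The canonical feature map `x ↦ k(·, x)` of an RKHS of real functions. -/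
def feature (x : X) : H := RKHS.kerFun H x 1

/-- The scalar kernel `k(x, y)` of an RKHS of real functions. -/
def scalarKernel (x y : X) : ℝ := RKHS.kernel H x y 1

theorem inner_feature {H : Type*} [NormedAddCommGroup H] [InnerProductSpace ℝ H]
    [CompleteSpace H] [RKHS ℝ H X ℝ] (h : H) (x : X) : inner ℝ h (feature H x) = h x := by
  simp [feature]

theorem scalarKernel_eq_inner (x y : X) :
    scalarKernel H x y = inner ℝ (feature H x) (feature H y) := by
  rw [real_inner_comm, inner_feature, feature, RKHS.kerFun_apply, scalarKernel]

/-- The regularity required of an RKHS with respect to a measure `μ` on its domain: it is separable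
and its kernel is continuous and `μ`-a.e. bounded. (The bound is stated on the diagonal; by
`|k(x, y)|² ≤ k(x, x) k(y, y)` it controls the whole kernel.) -/
structure Admissible [TopologicalSpace X] [MeasurableSpace X] (μ : Measure X) : Prop where
  separable : TopologicalSpace.SeparableSpace H
  continuous_kernel : Continuous fun p : X × X => scalarKernel H p.1 p.2
  ae_bounded : ∃ C : ℝ, ∀ᵐ x ∂μ, scalarKernel H x x ≤ C

/-- `C₀`-universality: the RKHS consists of functions in `C₀(X)` (continuous functions vanishing at
infinity; all continuous functions when `X` is compact), and it is dense in `C₀(X)` for the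
supremum norm. -/
def IsC0Universal [TopologicalSpace X] : Prop :=
  (∀ h : H, ∃ g : ZeroAtInftyContinuousMap X ℝ, ∀ x, g x = h x) ∧
    ∀ g : ZeroAtInftyContinuousMap X ℝ, ∀ ε : ℝ, 0 < ε → ∃ h : H, ∀ x, |g x - h x| < ε

variable {H}

theorem Admissible.exists_bound [TopologicalSpace X] [MeasurableSpace X]
    {μ : Measure X} (hH : Admissible H μ) :
    ∃ C : ℝ, 0 ≤ C ∧ ∀ h : H, ∀ᵐ x ∂μ, ‖h x‖ ≤ C * ‖h‖ := by
  obtain ⟨C, hC⟩ := hH.ae_bounded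
  refine ⟨√C, Real.sqrt_nonneg _, fun h => ?_⟩
  filter_upwards [hC] with x hx
  have h1 : ‖feature H x‖ ≤ √C := by
    rw [scalarKernel_eq_inner, real_inner_self_eq_norm_sq] at hx
    exact Real.le_sqrt_of_sq_le hx
  calc ‖h x‖ = ‖inner ℝ h (feature H x)‖ := by rw [inner_feature]
    _ ≤ ‖h‖ * ‖feature H x‖ := norm_inner_le_norm _ _
    _ ≤ ‖h‖ * √C := by gcongr
    _ = √C * ‖h‖ := mul_comm _ _

section Inclusion

variable [TopologicalSpace X] [MeasurableSpace X] {μ : Measure X}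

theorem Admissible.continuous_feature (hH : Admissible H μ) : Continuous (feature H) := by
  have hk := hH.continuous_kernel
  refine continuous_iff_continuousAt.2 fun x₀ => ?_
  have h1 : ∀ x, scalarKernel H x x - 2 * scalarKernel H x x₀ + scalarKernel H x₀ x₀ =
      ‖feature H x - feature H x₀‖ ^ 2 := by
    intro x
    rw [scalarKernel_eq_inner, scalarKernel_eq_inner, scalarKernel_eq_inner,
      real_inner_self_eq_norm_sq, real_inner_self_eq_norm_sq, ← norm_sub_sq_real]
  have hd : Continuous fun x => scalarKernel H x x :=
    Continuous.comp (g := fun p : X × X => scalarKernel H p.1 p.2) (f := fun x => (x, x)) hk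
      (continuous_id.prodMk continuous_id)
  have hx : Continuous fun x => scalarKernel H x x₀ :=
    Continuous.comp (g := fun p : X × X => scalarKernel H p.1 p.2) (f := fun x => (x, x₀)) hk
      (continuous_id.prodMk continuous_const)
  have h2 : Continuous fun x => ‖feature H x - feature H x₀‖ := by
    have h3 := ((hd.sub (continuous_const.mul hx)).add
      (continuous_const (y := scalarKernel H x₀ x₀))).sqrt (f := fun x =>
        scalarKernel H x x - 2 * scalarKernel H x x₀ + scalarKernel H x₀ x₀)
    simp only [h1, Real.sqrt_sq (norm_nonneg _)] at h3
    exact h3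
  have h4 := h2.tendsto x₀
  rw [sub_self, norm_zero] at h4
  exact tendsto_iff_norm_sub_tendsto_zero.2 h4

theorem Admissible.continuous_apply (hH : Admissible H μ) (h : H) : Continuous fun x => h x := by
  have h1 : (fun x => h x) = fun x => inner ℝ h (feature H x) := by
    funext x
    rw [inner_feature]
  rw [h1]
  exact continuous_const.inner hH.continuous_feature

variable [OpensMeasurableSpace X] [IsFiniteMeasure μ]

theorem Admissible.memLp (hH : Admissible H μ) (h : H) : MemLp (fun x => h x) 2 μ := by
  obtain ⟨C, -, hC⟩ := hH.exists_bound
  exact MemLp.of_bound (hH.continuous_apply h).measurable.aestronglyMeasurable _ (hC h)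

/-- The inclusion `S_μ : H → L²(μ)`, `h ↦ [h]`, of an RKHS into the space of square-integrable
functions. -/
def inclusion (hH : Admissible H μ) : H →L[ℝ] Lp ℝ 2 μ :=
  LinearMap.mkContinuousOfExistsBound
    { toFun := fun h => (hH.memLp h).toLp (fun x => h x)
      map_add' := fun h₁ h₂ => by
        rw [← MemLp.toLp_add]
        exact MemLp.toLp_congr _ _ (Filter.EventuallyEq.of_eq (RKHS.coe_add h₁ h₂))
      map_smul' := fun c h => by
        rw [RingHom.id_apply, ← MemLp.toLp_const_smul]
        exact MemLp.toLp_congr _ _ (Filter.EventuallyEq.of_eq (RKHS.coe_smul h c)) } (by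
    obtain ⟨C, hC0, hC⟩ := hH.exists_bound
    refine ⟨(measureUnivNNReal μ : ℝ) ^ (2 : ℝ≥0∞).toReal⁻¹ * C, fun h => ?_⟩
    have h1 : ∀ᵐ x ∂μ, ‖(hH.memLp h).toLp (fun x => h x) x‖ ≤ C * ‖h‖ := by
      filter_upwards [hC h, (hH.memLp h).coeFn_toLp] with x hx hx'
      rwa [hx']
    have h2 := Lp.norm_le_of_ae_bound (mul_nonneg hC0 (norm_nonneg h)) h1
    rw [mul_assoc]
    exact h2)

theorem inclusion_apply (hH : Admissible H μ) (h : H) :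
    inclusion hH h = (hH.memLp h).toLp (fun x => h x) := by
  rw [inclusion, LinearMap.mkContinuousOfExistsBound_apply]
  rfl

end Inclusion

end Kernels

/-! ### The range space `H_Z = H_X ⊕ (H_U ⊗ H_X)` -/

section Range

variable {X U : Type*}
  (HX : Type*) [NormedAddCommGroup HX] [InnerProductSpace ℝ HX] [CompleteSpace HX] [RKHS ℝ HX X ℝ]
  (HU : Type*) [NormedAddCommGroup HU] [InnerProductSpace ℝ HU] [CompleteSpace HU] [RKHS ℝ HU U ℝ]

/-- The Hilbert space direct sum `H_X ⊕ (H_U ⊗ H_X)`, where `⊗` is the Hilbert space tensor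
product, i.e. the completion of the algebraic one. -/
abbrev DirectSumSpace : Type _ :=
  WithLp 2 (HX × UniformSpace.Completion (HU ⊗[ℝ] HX))

/-- The feature map `(x, u) ↦ (φ_X(x), φ_U(u) ⊗ φ_X(x))`. A vector `v` of `H_X ⊕ (H_U ⊗ H_X)` is
read as the function `z ↦ ⟨v, rangeFeature z⟩`; in particular `(a, b ⊗ c)` is read as
`(x, u) ↦ a(x) + b(u) c(x)`. -/
def rangeFeature (z : X × U) : DirectSumSpace HX HU :=
  WithLp.toLp 2 (feature HX z.1,
    ((feature HU z.2 ⊗ₜ[ℝ] feature HX z.1 : HU ⊗[ℝ] HX) : UniformSpace.Completion (HU ⊗[ℝ] HX)))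

/-- `H_Z` is the RKHS of the functions on `X × U` that `H_X ⊕ (H_U ⊗ H_X)` represents, i.e. the RKHS
with kernel `k_Z(z, z') = ⟨rangeFeature z, rangeFeature z'⟩`. (If no nonzero vector of the direct sum
represents the zero function, `H_Z` is isometric to the direct sum itself; otherwise it is its
quotient by the vectors representing zero.) -/
def IsRangeRKHS (HZ : Type*) [NormedAddCommGroup HZ] [InnerProductSpace ℝ HZ] [CompleteSpace HZ]
    [RKHS ℝ HZ (X × U) ℝ] : Prop :=
  ∀ z z' : X × U,
    scalarKernel HZ z z' = inner ℝ (rangeFeature HX HU z) (rangeFeature HX HU z')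

/-- The kernel of the range space is `k_X(x, x') (1 + k_U(u, u'))`. -/
theorem inner_rangeFeature (z z' : X × U) :
    inner ℝ (rangeFeature HX HU z) (rangeFeature HX HU z') =
      scalarKernel HX z.1 z'.1 * (1 + scalarKernel HU z.2 z'.2) := by
  simp only [rangeFeature, WithLp.prod_inner_apply, UniformSpace.Completion.inner_coe,
    TensorProduct.inner_tmul, scalarKernel_eq_inner]
  ring

end Range

/-! ### The control Koopman operator -/

section Koopman

variable {X Z : Type*} [MeasurableSpace X] [MeasurableSpace Z]

/-- Composition with `f` is bounded from `L²(μ)` to `L²(ν)`. -/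
def KoopmanBounded (f : Z → X) (μ : Measure X) (ν : Measure Z) : Prop :=
  ∃ L : ℝ≥0, ∀ y : X → ℝ, MemLp y 2 μ → eLpNorm (y ∘ f) 2 ν ≤ L * eLpNorm y 2 μ

variable {f : Z → X} {μ : Measure X} {ν : Measure Z}

theorem KoopmanBounded.quasiMeasurePreserving (h : KoopmanBounded f μ ν) (hf : Measurable f) :
    Measure.QuasiMeasurePreserving f ν μ := by
  obtain ⟨L, hL⟩ := h
  refine ⟨hf, Measure.AbsolutelyContinuous.mk fun s hs hs0 => ?_⟩
  rw [Measure.map_apply hf hs]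
  have h0 : s.indicator (fun _ => (1 : ℝ)) =ᵐ[μ] 0 :=
    indicator_meas_zero hs0
  have hm : MemLp (s.indicator fun _ => (1 : ℝ)) 2 μ :=
    MemLp.ae_eq h0.symm MemLp.zero
  have h1 := hL _ hm
  rw [eLpNorm_congr_ae h0, eLpNorm_zero, mul_zero, nonpos_iff_eq_zero,
    eLpNorm_eq_zero_iff (((measurable_const.indicator hs).comp hf).aestronglyMeasurable)
      two_ne_zero] at h1
  have h2 : ∀ᵐ z ∂ν, z ∉ f ⁻¹' s := by
    filter_upwards [h1] with z hz hzs
    have : f z ∈ s := hzs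
    simp [this] at hz
  exact measure_eq_zero_iff_ae_notMem.2 h2

theorem KoopmanBounded.memLp_comp (h : KoopmanBounded f μ ν) (hf : Measurable f) {y : X → ℝ}
    (hy : MemLp y 2 μ) : MemLp (y ∘ f) 2 ν := by
  refine ⟨hy.1.comp_quasiMeasurePreserving (h.quasiMeasurePreserving hf), ?_⟩
  obtain ⟨L, hL⟩ := h
  exact (hL y hy).trans_lt (ENNReal.mul_lt_top ENNReal.coe_lt_top hy.2)

/-- The control Koopman operator `𝒢 : L²(μ) → L²(ν)`, `y ↦ y ∘ f`. -/
def koopman (hf : Measurable f) (h : KoopmanBounded f μ ν) : Lp ℝ 2 μ →L[ℝ] Lp ℝ 2 ν :=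
  LinearMap.mkContinuousOfExistsBound
    { toFun := fun y => (h.memLp_comp hf (Lp.memLp y)).toLp (y ∘ f)
      map_add' := fun y₁ y₂ => by
        rw [← MemLp.toLp_add]
        exact MemLp.toLp_congr _ _
          ((h.quasiMeasurePreserving hf).ae_eq_comp (Lp.coeFn_add y₁ y₂))
      map_smul' := fun c y => by
        rw [RingHom.id_apply, ← MemLp.toLp_const_smul]
        exact MemLp.toLp_congr _ _
          ((h.quasiMeasurePreserving hf).ae_eq_comp (Lp.coeFn_smul c y)) } (by
    obtain ⟨L, hL⟩ := h
    refine ⟨L, fun y => ?_⟩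
    have h1 := hL y (Lp.memLp y)
    have h2 : (L * eLpNorm y 2 μ : ℝ≥0∞) ≠ ⊤ :=
      ENNReal.mul_ne_top ENNReal.coe_ne_top (Lp.eLpNorm_ne_top y)
    have h3 := ENNReal.toReal_mono h2 h1
    rw [ENNReal.toReal_mul, ENNReal.coe_toReal, ← Lp.norm_def] at h3
    rw [LinearMap.coe_mk, AddHom.coe_mk, Lp.norm_toLp]
    exact h3)

theorem koopman_toLp (hf : Measurable f) (h : KoopmanBounded f μ ν) {y : X → ℝ}
    (hy : MemLp y 2 μ) : koopman hf h (hy.toLp y) =ᵐ[ν] y ∘ f :=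
  (MemLp.coeFn_toLp (h.memLp_comp hf (Lp.memLp (hy.toLp y)))).trans
    ((h.quasiMeasurePreserving hf).ae_eq_comp hy.coeFn_toLp)

end Koopman

/-! ### Hilbert-Schmidt and finite-rank operators, errors -/

section Operators

variable {E F : Type*} [NormedAddCommGroup E] [InnerProductSpace ℝ E]
  [NormedAddCommGroup F] [InnerProductSpace ℝ F]

/-- `A` is a Hilbert-Schmidt operator: `∑ ‖A eᵢ‖² < ∞` for the orthonormal bases `(eᵢ)` of `E`. -/
def IsHilbertSchmidt (A : E →L[ℝ] F) : Prop :=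
  ∀ (s : Set E) (b : HilbertBasis s ℝ E), Summable fun i => ‖A (b i)‖ ^ 2

/-- `A` has finite rank. -/
def IsFiniteRank (A : E →L[ℝ] F) : Prop :=
  FiniteDimensional ℝ (LinearMap.range (A : E →ₗ[ℝ] F))

variable {L : Type*} [NormedAddCommGroup L] [InnerProductSpace ℝ L] [CompleteSpace L]

/-- The operator norm error `‖T - S G‖` of `G : E → F` as an approximation of `T : E → L`, the space
`F` being mapped to `L` by `S`. -/
def opError (T : E →L[ℝ] L) (S : F →L[ℝ] L) (G : E →L[ℝ] F) : ℝ := ‖T - S ∘L G‖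

/-- The orthogonal projector onto the closure of the range of `S`. -/
def rangeProjector (S : F →L[ℝ] L) : L →L[ℝ] L :=
  (LinearMap.range (S : F →ₗ[ℝ] L)).topologicalClosure.starProjection

/-- The representation bias `‖(I - P) T‖`, `P` the orthogonal projector onto the closure of the
range of `S`. -/
def representationBias (T : E →L[ℝ] L) (S : F →L[ℝ] L) : ℝ :=
  ‖(ContinuousLinearMap.id ℝ L - rangeProjector S) ∘L T‖

end Operators

end

end ControlKoopman

/-!
The error splits as `T - S G = (I - P) T + (P T - S G)`. The first part has norm `B`, so the claim
is that finite-rank operators `G` make the second part arbitrarily small. This holds because `T` is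
compact, in the following concrete form: the domain being compact and the feature map continuous,
the features `φ(x)` lie within `ε` of a finite-dimensional subspace `W` of `H_X`, and since
`h(x) = ⟨h, φ(x)⟩`, the inclusion into `L²`, and with it `T`, hardly changes when it is preceded by
the projector onto `W` (`exists_norm_inclusion_sub_comp_starProjection_le`). On `W` there are only
finitely many basis vectors `w` for which `P T w`, a point of the closed range of `S`, has to be
replaced by some `S h` (`exists_isFiniteRank_opError_lt`). Finite-rank operators are
Hilbert-Schmidt.

Conversely `(I - P) T = (I - P) (T - S G)`, so that `B` is at most the error of any `G`
(`representationBias_le_opError`); hence arbitrarily small errors force `B = 0`.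

For `C₀`-universal `H_X` and `H_U`, the space `H_Z` is uniformly dense in `C(X × U)`
(`IsRangeRKHS.dense_continuousMembers`): it approximates the products `b(u) c(x)` with `b ∈ H_U` and
`c ∈ H_X`, hence all products `q(u) p(x)` of continuous functions, and these span a dense subalgebra
by the Stone-Weierstrass theorem. Since `T h` is the class of the continuous function `h ∘ f`, it
lies in the closed range of `S`, that is, `(I - P) T h = 0`.
-/

namespace ControlKoopman

/-! ### Finite-rank operators and the representation bias -/

section Operators

variable {E F L : Type*} [NormedAddCommGroup E] [InnerProductSpace ℝ E]
  [NormedAddCommGroup F] [InnerProductSpace ℝ F]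
  [NormedAddCommGroup L] [InnerProductSpace ℝ L]

/-- In an orthonormal basis `e` of the range, `‖A bᵢ‖² = ∑ⱼ ⟨eⱼ, A bᵢ⟩²`, and each summand is the
square of a bounded functional at `bᵢ`, so that Bessel's inequality applies. -/
theorem IsFiniteRank.isHilbertSchmidt [CompleteSpace E] {A : E →L[ℝ] F} (hA : IsFiniteRank A) :
    IsHilbertSchmidt A := by
  intro s b
  let R : Submodule ℝ F := LinearMap.range (A : E →ₗ[ℝ] F)
  have : FiniteDimensional ℝ R := hA
  let e := stdOrthonormalBasis ℝ R
  have hnorm : ∀ x, ‖A x‖ ^ 2 = ∑ j, ‖inner ℝ (e j : F) (A x)‖ ^ 2 := fun x =>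
    (e.sum_sq_norm_inner_right ⟨A x, LinearMap.mem_range_self (A : E →ₗ[ℝ] F) x⟩).symm
  simp only [hnorm]
  refine summable_sum fun j _ => ?_
  let w := (InnerProductSpace.toDual ℝ E).symm (innerSL ℝ (e j : F) ∘L A)
  have hw : ∀ x, inner ℝ (e j : F) (A x) = inner ℝ x w := fun x => by
    rw [real_inner_comm w x, InnerProductSpace.toDual_symm_apply]
    rfl
  simp only [hw]
  exact b.orthonormal.inner_products_summable w

/-- `(I - P) T = (I - P) (T - S G)`, because `P` fixes the range of `S`. -/
theorem representationBias_le_opError [CompleteSpace L] (T : E →L[ℝ] L) (S : F →L[ℝ] L)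
    (G : E →L[ℝ] F) : representationBias T S ≤ opError T S G := by
  have hS : ∀ v, rangeProjector S (S v) = S v := fun v =>
    Submodule.starProjection_eq_self_iff.2
      (Submodule.le_topologicalClosure _ (LinearMap.mem_range_self (S : F →ₗ[ℝ] L) v))
  have hfactor : (ContinuousLinearMap.id ℝ L - rangeProjector S) ∘L T =
      (ContinuousLinearMap.id ℝ L - rangeProjector S) ∘L (T - S ∘L G) := by
    ext x
    simp [hS]
  have hle : ‖ContinuousLinearMap.id ℝ L - rangeProjector S‖ ≤ 1 := by
    rw [rangeProjector, ← Submodule.starProjection_orthogonal]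
    exact Submodule.starProjection_norm_le _
  calc representationBias T S
      = ‖(ContinuousLinearMap.id ℝ L - rangeProjector S) ∘L (T - S ∘L G)‖ := by
        rw [representationBias, hfactor]
    _ ≤ ‖ContinuousLinearMap.id ℝ L - rangeProjector S‖ * ‖T - S ∘L G‖ :=
        ContinuousLinearMap.opNorm_comp_le _ _
    _ ≤ 1 * ‖T - S ∘L G‖ := by gcongr
    _ = opError T S G := one_mul _

/-- An operator `T` which is a norm limit of its restrictions to finite-dimensional subspaces is
approximated through `S` by finite-rank operators up to the representation bias: on an orthonormal
basis `w` of such a subspace, `G` sends `wᵢ` to some `hᵢ` with `S hᵢ` close to `P T wᵢ`. -/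
theorem exists_isFiniteRank_opError_lt [CompleteSpace L] (T : E →L[ℝ] L) (S : F →L[ℝ] L)
    (hT : ∀ ε : ℝ, 0 < ε → ∃ (W : Submodule ℝ E) (_ : FiniteDimensional ℝ W),
      ‖T - T ∘L W.starProjection‖ ≤ ε) {δ : ℝ} (hδ : 0 < δ) :
    ∃ G : E →L[ℝ] F, IsFiniteRank G ∧ opError T S G < representationBias T S + δ := by
  obtain ⟨W, _, hW⟩ := hT (δ / 3) (by positivity)
  let w := stdOrthonormalBasis ℝ W
  let d := Module.finrank ℝ W
  let P := rangeProjector S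
  have hP : ‖P‖ ≤ 1 := Submodule.starProjection_norm_le _
  have hη : 0 < δ / 3 / (d + 1) := by positivity
  have hex : ∀ i, ∃ h : F, ‖P (T (w i)) - S h‖ ≤ δ / 3 / (d + 1) := fun i => by
    have hmem : P (T (w i)) ∈ closure (Set.range S) :=
      Submodule.starProjection_apply_mem (LinearMap.range (S : F →ₗ[ℝ] L)).topologicalClosure _
    obtain ⟨_, ⟨h, rfl⟩, hh⟩ := Metric.mem_closure_iff.1 hmem _ hη
    exact ⟨h, by rw [← dist_eq_norm]; exact hh.le⟩
  choose h hh using hex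
  let G : E →L[ℝ] F := ∑ i, (innerSL ℝ (w i : E)).smulRight (h i)
  have hGx : ∀ x, G x = ∑ i, inner ℝ (w i : E) x • h i := fun x => by
    simp [G]
  refine ⟨G, ?_, ?_⟩
  · have hsub : LinearMap.range (G : E →ₗ[ℝ] F) ≤ Submodule.span ℝ (Set.range h) := by
      rintro _ ⟨x, rfl⟩
      change G x ∈ _
      rw [hGx]
      exact Submodule.sum_mem _ fun i _ =>
        Submodule.smul_mem _ _ (Submodule.subset_span (Set.mem_range_self i))
    have : FiniteDimensional ℝ (Submodule.span ℝ (Set.range h)) :=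
      FiniteDimensional.span_of_finite ℝ (Set.finite_range h)
    exact Submodule.finiteDimensional_of_le hsub
  · have hQ : ∀ x, W.starProjection x = ∑ i, inner ℝ (w i : E) x • (w i : E) := fun x => by
      rw [OrthonormalBasis.starProjection_eq_sum_rankOne w]
      simp
    have hlast : ‖P ∘L (T ∘L W.starProjection) - S ∘L G‖ ≤ δ / 3 := by
      refine ContinuousLinearMap.opNorm_le_bound _ (by positivity) fun x => ?_
      have hsum : (P ∘L (T ∘L W.starProjection) - S ∘L G) x =
          ∑ i, inner ℝ (w i : E) x • (P (T (w i)) - S (h i)) := by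
        simp [hQ, hGx, smul_sub, Finset.sum_sub_distrib]
      rw [hsum]
      calc ‖∑ i, inner ℝ (w i : E) x • (P (T (w i)) - S (h i))‖
          ≤ ∑ _i : Fin d, ‖x‖ * (δ / 3 / (d + 1)) := by
            refine norm_sum_le_of_le _ fun i _ => ?_
            rw [norm_smul]
            have hwi : ‖(w i : E)‖ = 1 := w.norm_eq_one i
            have h1 := norm_inner_le_norm (𝕜 := ℝ) (w i : E) x
            rw [hwi, one_mul] at h1
            exact mul_le_mul h1 (hh i) (norm_nonneg _) (norm_nonneg _)
        _ = δ / 3 * ‖x‖ * (d / (d + 1)) := by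
            rw [Finset.sum_const, Finset.card_univ, Fintype.card_fin, nsmul_eq_mul]
            ring
        _ ≤ δ / 3 * ‖x‖ * 1 := by
            gcongr
            rw [div_le_one (by positivity)]
            linarith
        _ = δ / 3 * ‖x‖ := mul_one _
    have hmid : ‖P ∘L (T - T ∘L W.starProjection)‖ ≤ δ / 3 :=
      calc ‖P ∘L (T - T ∘L W.starProjection)‖ ≤ ‖P‖ * ‖T - T ∘L W.starProjection‖ :=
            ContinuousLinearMap.opNorm_comp_le _ _
        _ ≤ 1 * (δ / 3) := mul_le_mul hP hW (norm_nonneg _) zero_le_one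
        _ = δ / 3 := one_mul _
    have hsplit : T - S ∘L G = (ContinuousLinearMap.id ℝ L - P) ∘L T +
        P ∘L (T - T ∘L W.starProjection) + (P ∘L (T ∘L W.starProjection) - S ∘L G) := by
      ext x
      simp
    calc opError T S G ≤ representationBias T S + δ / 3 + δ / 3 := by
          rw [opError, hsplit]
          exact (norm_add₃_le).trans (add_le_add (add_le_add le_rfl hmid) hlast)
      _ < representationBias T S + δ := by linarith

end Operators

/-! ### Compactness of the inclusion into `L²` -/

section Inclusion

variable {X : Type*} {H : Type*} [NormedAddCommGroup H] [InnerProductSpace ℝ H]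
  [CompleteSpace H] [RKHS ℝ H X ℝ]
  [TopologicalSpace X] [MeasurableSpace X] {μ : Measure X} [OpensMeasurableSpace X]
  [IsFiniteMeasure μ]

theorem norm_inclusion_le (hH : Admissible H μ) (h : H) {c : ℝ} (hc : 0 ≤ c)
    (hh : ∀ x, ‖h x‖ ≤ c) :
    ‖inclusion hH h‖ ≤ (measureUnivNNReal μ : ℝ) ^ (2 : ℝ≥0∞).toReal⁻¹ * c := by
  rw [inclusion_apply]
  refine Lp.norm_le_of_ae_bound hc ?_
  filter_upwards [(hH.memLp h).coeFn_toLp] with x hx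
  rw [hx]
  exact hh x

/-- On a compact domain the features form a compact set, hence lie uniformly close to a
finite-dimensional subspace `W`; since `(h - Q h)(x) = ⟨h, φ(x) - Q φ(x)⟩` for the projector `Q`
onto `W`, the inclusion is uniformly close to its restriction to `W`. -/
theorem exists_norm_inclusion_sub_comp_starProjection_le [CompactSpace X] (hH : Admissible H μ)
    {ε : ℝ} (hε : 0 < ε) :
    ∃ (W : Submodule ℝ H) (_ : FiniteDimensional ℝ W),
      ‖inclusion hH - inclusion hH ∘L W.starProjection‖ ≤ ε := by
  set M : ℝ := (measureUnivNNReal μ : ℝ) ^ (2 : ℝ≥0∞).toReal⁻¹ with hM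
  have hM0 : 0 ≤ M := by positivity
  have hη : 0 < ε / (M + 1) := by positivity
  obtain ⟨t, ht, hcover⟩ := Metric.totallyBounded_iff.1
    (isCompact_range hH.continuous_feature).totallyBounded _ hη
  have hfd : FiniteDimensional ℝ (Submodule.span ℝ t) := FiniteDimensional.span_of_finite ℝ ht
  refine ⟨Submodule.span ℝ t, hfd, ContinuousLinearMap.opNorm_le_bound _ hε.le fun h => ?_⟩
  set Q := (Submodule.span ℝ t).starProjection with hQ
  have hfeature : ∀ x, ‖feature H x - Q (feature H x)‖ ≤ ε / (M + 1) := fun x => by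
    obtain ⟨y, hy, hxy⟩ := Set.mem_iUnion₂.1 (hcover (Set.mem_range_self x))
    rw [hQ, Submodule.starProjection_minimal]
    refine (ciInf_le ⟨0, ?_⟩ (⟨y, Submodule.subset_span hy⟩ : Submodule.span ℝ t)).trans ?_
    · rintro _ ⟨_, rfl⟩
      exact norm_nonneg _
    · rw [← dist_eq_norm]
      exact (Metric.mem_ball.1 hxy).le
  have happly : ∀ x, ‖(h - Q h) x‖ ≤ ε / (M + 1) * ‖h‖ := fun x => by
    have heq : (h - Q h) x = inner ℝ h (feature H x - Q (feature H x)) := by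
      rw [← inner_feature, inner_sub_left, inner_sub_right,
        Submodule.inner_starProjection_left_eq_right]
    rw [heq, mul_comm]
    exact (norm_inner_le_norm _ _).trans (by gcongr; exact hfeature x)
  have hsub : (inclusion hH - inclusion hH ∘L Q) h = inclusion hH (h - Q h) := by simp
  rw [hsub]
  calc ‖inclusion hH (h - Q h)‖ ≤ M * (ε / (M + 1) * ‖h‖) :=
        norm_inclusion_le hH _ (by positivity) happly
    _ = ε * ‖h‖ * (M / (M + 1)) := by ring
    _ ≤ ε * ‖h‖ * 1 := by
        gcongr
        rw [div_le_one (by positivity)]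
        linarith
    _ = ε * ‖h‖ := mul_one _

theorem exists_norm_comp_inclusion_sub_le [CompactSpace X] (hH : Admissible H μ)
    {L : Type*} [NormedAddCommGroup L] [InnerProductSpace ℝ L] (K : Lp ℝ 2 μ →L[ℝ] L)
    {ε : ℝ} (hε : 0 < ε) :
    ∃ (W : Submodule ℝ H) (_ : FiniteDimensional ℝ W),
      ‖K ∘L inclusion hH - (K ∘L inclusion hH) ∘L W.starProjection‖ ≤ ε := by
  obtain ⟨W, hW, hle⟩ := exists_norm_inclusion_sub_comp_starProjection_le hH
    (show 0 < ε / (‖K‖ + 1) by positivity)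
  refine ⟨W, hW, ?_⟩
  rw [ContinuousLinearMap.comp_assoc, ← ContinuousLinearMap.comp_sub]
  calc ‖K ∘L (inclusion hH - inclusion hH ∘L W.starProjection)‖
      ≤ ‖K‖ * ‖inclusion hH - inclusion hH ∘L W.starProjection‖ :=
        ContinuousLinearMap.opNorm_comp_le _ _
    _ ≤ (‖K‖ + 1) * (ε / (‖K‖ + 1)) := by gcongr; linarith
    _ = ε := by field_simp

end Inclusion

/-! ### Uniform approximation by functions of an RKHS -/

section Density

variable {X : Type*} [TopologicalSpace X] (H : Type*) [NormedAddCommGroup H]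
  [InnerProductSpace ℝ H] [RKHS ℝ H X ℝ]

/-- The continuous functions that belong to the RKHS `H`. -/
def continuousMembers : Submodule ℝ C(X, ℝ) where
  carrier := {F | ∃ h : H, ∀ x, h x = F x}
  add_mem' := by
    rintro F F' ⟨h, hh⟩ ⟨h', hh'⟩
    exact ⟨h + h', fun x => by simp [hh, hh']⟩
  zero_mem' := ⟨0, fun x => by simp⟩
  smul_mem' := by
    rintro c F ⟨h, hh⟩
    exact ⟨c • h, fun x => by simp [hh]⟩

variable {H}

theorem IsC0Universal.dense_continuousMembers [CompactSpace X] [CompleteSpace H]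
    (hH : IsC0Universal H) (F : C(X, ℝ)) : F ∈ closure (continuousMembers H : Set C(X, ℝ)) := by
  refine Metric.mem_closure_iff.2 fun ε hε => ?_
  obtain ⟨h, hh⟩ := hH.2 (ZeroAtInftyContinuousMap.ContinuousMap.liftZeroAtInfty F) ε hε
  obtain ⟨g, hg⟩ := hH.1 h
  refine ⟨g, ⟨h, fun x => (hg x).symm⟩, (ContinuousMap.dist_lt_iff hε).2 fun x => ?_⟩
  rw [Real.dist_eq]
  have := hh x
  rw [← hg x] at this
  exact this

theorem inclusion_mem_closure_range [CompactSpace X] [CompleteSpace H] [MeasurableSpace X]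
    [BorelSpace X] {μ : Measure X} [IsFiniteMeasure μ] (hH : Admissible H μ) {F : C(X, ℝ)}
    (hF : F ∈ closure (continuousMembers H : Set C(X, ℝ))) :
    ContinuousMap.toLp 2 μ ℝ F ∈ closure (Set.range (inclusion hH)) := by
  refine map_mem_closure (ContinuousMap.toLp 2 μ ℝ).continuous hF ?_
  rintro F ⟨h, hh⟩
  refine ⟨h, Lp.ext ?_⟩
  rw [inclusion_apply]
  filter_upwards [(hH.memLp h).coeFn_toLp, ContinuousMap.coeFn_toLp (𝕜 := ℝ) (p := 2) μ F]
    with x hx hx'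
  rw [hx, hx', hh]

end Density

section Range

variable {X U : Type*}
  {HX : Type*} [NormedAddCommGroup HX] [InnerProductSpace ℝ HX] [CompleteSpace HX] [RKHS ℝ HX X ℝ]
  {HU : Type*} [NormedAddCommGroup HU] [InnerProductSpace ℝ HU] [CompleteSpace HU] [RKHS ℝ HU U ℝ]
  {HZ : Type*} [NormedAddCommGroup HZ] [InnerProductSpace ℝ HZ] [CompleteSpace HZ]
  [RKHS ℝ HZ (X × U) ℝ]

theorem IsRangeRKHS.exists_apply_eq_inner (hZ : IsRangeRKHS HX HU HZ) {v : DirectSumSpace HX HU}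
    (hv : v ∈ Submodule.span ℝ (Set.range (rangeFeature HX HU))) :
    ∃ h : HZ, ∀ z, h z = inner ℝ v (rangeFeature HX HU z) := by
  induction hv using Submodule.span_induction with
  | mem v hv =>
    obtain ⟨z', rfl⟩ := hv
    exact ⟨feature HZ z', fun z => by
      rw [← hZ z' z, scalarKernel_eq_inner, inner_feature]⟩
  | zero => exact ⟨0, fun z => by simp⟩
  | add v v' _ _ h h' =>
    obtain ⟨g, hg⟩ := h
    obtain ⟨g', hg'⟩ := h'
    exact ⟨g + g', fun z => by simp [hg, hg', inner_add_left]⟩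
  | smul c v _ h =>
    obtain ⟨g, hg⟩ := h
    exact ⟨c • g, fun z => by simp [hg, real_inner_smul_left, mul_add]⟩

variable [TopologicalSpace X] [TopologicalSpace U] [CompactSpace X] [CompactSpace U]
  [MeasurableSpace (X × U)] {ν : Measure (X × U)}

theorem IsRangeRKHS.exists_norm_rangeFeature_le (hZ : IsRangeRKHS HX HU HZ)
    (hHZ : Admissible HZ ν) : ∃ C : ℝ, 0 ≤ C ∧ ∀ z, ‖rangeFeature HX HU z‖ ≤ C := by
  obtain ⟨C, hC⟩ := (isCompact_range hHZ.continuous_feature).isBounded.exists_norm_le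
  refine ⟨|C|, abs_nonneg _, fun z => ?_⟩
  have heq : ‖rangeFeature HX HU z‖ ^ 2 = ‖feature HZ z‖ ^ 2 := by
    rw [← real_inner_self_eq_norm_sq, ← real_inner_self_eq_norm_sq, ← hZ z z,
      scalarKernel_eq_inner]
  rw [(sq_eq_sq₀ (norm_nonneg _) (norm_nonneg _)).1 heq]
  exact (hC _ (Set.mem_range_self z)).trans (le_abs_self C)

/-- A function represented by a vector `v` of the direct sum is a uniform limit of functions in
`H_Z`: the part of `v` orthogonal to all features represents zero, and the rest is a limit of
combinations of features, whose functions lie in `H_Z`. -/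
theorem IsRangeRKHS.mem_closure_of_eq_inner (hZ : IsRangeRKHS HX HU HZ) (hHZ : Admissible HZ ν)
    (v : DirectSumSpace HX HU) {F : C(X × U, ℝ)}
    (hF : ∀ z, F z = inner ℝ v (rangeFeature HX HU z)) :
    F ∈ closure (continuousMembers HZ : Set C(X × U, ℝ)) := by
  obtain ⟨C, hC0, hC⟩ := hZ.exists_norm_rangeFeature_le hHZ
  refine Metric.mem_closure_iff.2 fun ε hε => ?_
  let V := (Submodule.span ℝ (Set.range (rangeFeature HX HU))).topologicalClosure
  have hproj : V.starProjection v ∈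
      closure (Submodule.span ℝ (Set.range (rangeFeature HX HU)) : Set (DirectSumSpace HX HU)) :=
    V.starProjection_apply_mem v
  obtain ⟨w, hw, hdist⟩ := Metric.mem_closure_iff.1 hproj (ε / (C + 1)) (by positivity)
  obtain ⟨h, hh⟩ := hZ.exists_apply_eq_inner hw
  refine ⟨⟨h, hHZ.continuous_apply h⟩, ⟨h, fun _ => rfl⟩,
    (ContinuousMap.dist_lt_iff hε).2 fun z => ?_⟩
  have hmem : rangeFeature HX HU z ∈ V :=
    Submodule.le_topologicalClosure _ (Submodule.subset_span (Set.mem_range_self z))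
  have hdiff : F z - h z = inner ℝ (V.starProjection v - w) (rangeFeature HX HU z) := by
    rw [hF, hh, inner_sub_left, Submodule.inner_starProjection_left_eq_right,
      Submodule.starProjection_eq_self_iff.2 hmem]
  rw [dist_eq_norm] at hdist ⊢
  calc ‖F z - h z‖ ≤ ‖V.starProjection v - w‖ * ‖rangeFeature HX HU z‖ := by
        rw [hdiff]
        exact norm_inner_le_norm _ _
    _ ≤ ε / (C + 1) * C := mul_le_mul hdist.le (hC z) (norm_nonneg _) (by positivity)
    _ < ε := by
        rw [div_mul_eq_mul_div, div_lt_iff₀ (by positivity)]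
        linarith

/-- The function `(x, u) ↦ p x * q u`. -/
def tensorMap (p : C(X, ℝ)) (q : C(U, ℝ)) : C(X × U, ℝ) :=
  p.comp .fst * q.comp .snd

theorem IsRangeRKHS.tensorMap_mem_closure (hZ : IsRangeRKHS HX HU HZ) (hHZ : Admissible HZ ν)
    (hX : IsC0Universal HX) (hU : IsC0Universal HU) (p : C(X, ℝ)) (q : C(U, ℝ)) :
    tensorMap p q ∈ closure (continuousMembers HZ : Set C(X × U, ℝ)) := by
  have hcont : Continuous (Function.uncurry fun (p : C(X, ℝ)) (q : C(U, ℝ)) => tensorMap p q) := by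
    unfold tensorMap Function.uncurry
    fun_prop
  rw [← isClosed_closure.closure_eq]
  refine map_mem_closure₂ hcont (hX.dense_continuousMembers p) (hU.dense_continuousMembers q) ?_
  rintro p ⟨c, hc⟩ q ⟨b, hb⟩
  refine hZ.mem_closure_of_eq_inner hHZ
    (WithLp.toLp 2 (0, ((b ⊗ₜ[ℝ] c : HU ⊗[ℝ] HX) : UniformSpace.Completion (HU ⊗[ℝ] HX))))
    fun z => ?_
  simp [tensorMap, rangeFeature, WithLp.prod_inner_apply, UniformSpace.Completion.inner_coe,
    TensorProduct.inner_tmul, inner_feature, hc, hb, mul_comm]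

/-- By the Stone-Weierstrass theorem, since the products `tensorMap p q` are closed under
multiplication and separate points. -/
theorem IsRangeRKHS.dense_continuousMembers [T2Space X] [T2Space U] (hZ : IsRangeRKHS HX HU HZ)
    (hHZ : Admissible HZ ν) (hX : IsC0Universal HX) (hU : IsC0Universal HU) (F : C(X × U, ℝ)) :
    F ∈ closure (continuousMembers HZ : Set C(X × U, ℝ)) := by
  let M : Submonoid C(X × U, ℝ) :=
    { carrier := Set.range fun pq : C(X, ℝ) × C(U, ℝ) => tensorMap pq.1 pq.2
      one_mem' := ⟨(1, 1), by ext; simp [tensorMap]⟩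
      mul_mem' := by
        rintro _ _ ⟨⟨p, q⟩, rfl⟩ ⟨⟨p', q'⟩, rfl⟩
        exact ⟨(p * p', q * q'), by ext; simp [tensorMap]; ring⟩ }
  let A : Subalgebra ℝ C(X × U, ℝ) := Algebra.adjoin ℝ M
  have hsep : A.SeparatesPoints := by
    rintro ⟨x, u⟩ ⟨x', u'⟩ hne
    have hmem : ∀ p q, tensorMap p q ∈ A := fun p q => Algebra.subset_adjoin ⟨(p, q), rfl⟩
    by_cases hx : x = x'
    · obtain ⟨g, hg⟩ := exists_continuous_zero_one_of_isClosed (isClosed_singleton (x := u))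
        (isClosed_singleton (x := u')) (by
          rw [Set.disjoint_singleton]
          rintro rfl
          exact hne (by rw [hx]))
      refine ⟨_, ⟨_, hmem 1 g, rfl⟩, ?_⟩
      simp [tensorMap, hg.1 rfl, hg.2.1 rfl]
    · obtain ⟨g, hg⟩ := exists_continuous_zero_one_of_isClosed (isClosed_singleton (x := x))
        (isClosed_singleton (x := x')) (Set.disjoint_singleton.2 hx)
      refine ⟨_, ⟨_, hmem g 1, rfl⟩, ?_⟩
      simp [tensorMap, hg.1 rfl, hg.2.1 rfl]
  have hA : (A : Set C(X × U, ℝ)) ⊆ (continuousMembers HZ).topologicalClosure := by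
    intro G hG
    have hG' : G ∈ Submodule.span ℝ (M : Set C(X × U, ℝ)) := by
      rw [← Submonoid.closure_eq M, ← Algebra.adjoin_eq_span]
      exact hG
    refine Submodule.span_le.2 ?_ hG'
    rintro _ ⟨⟨p, q⟩, rfl⟩
    exact hZ.tensorMap_mem_closure hHZ hX hU p q
  exact closure_minimal hA (Submodule.isClosed_topologicalClosure _)
    (ContinuousMap.continuousMap_mem_subalgebra_closure_of_separatesPoints A hsep F)

end Range

end ControlKoopman

open ControlKoopman in
theorem theorem2 {nx nu : ℕ}
    (X : Set (EuclideanSpace ℝ (Fin nx))) (hX : IsCompact X)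
    (U : Set (EuclideanSpace ℝ (Fin nu))) (hU : IsCompact U)
    (f : X × U → X) (hf : Continuous f)
    (μ : Measure X) [IsFiniteMeasure μ] (ν : Measure (X × U)) [IsFiniteMeasure ν]
    (hG : KoopmanBounded f μ ν)
    (HX : Type*) [NormedAddCommGroup HX] [InnerProductSpace ℝ HX] [CompleteSpace HX]
    [RKHS ℝ HX X ℝ]
    (HU : Type*) [NormedAddCommGroup HU] [InnerProductSpace ℝ HU] [CompleteSpace HU]
    [RKHS ℝ HU U ℝ]
    (HZ : Type*) [NormedAddCommGroup HZ] [InnerProductSpace ℝ HZ] [CompleteSpace HZ]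
    [RKHS ℝ HZ (X × U) ℝ]
    (hZ : IsRangeRKHS HX HU HZ)
    (hHX : Admissible HX μ) (hHZ : Admissible HZ ν)
    (T : HX →L[ℝ] Lp ℝ 2 ν) (hT : T = koopman hf.measurable hG ∘L inclusion hHX) :
    (∀ δ : ℝ, 0 < δ → ∃ G : HX →L[ℝ] HZ, IsFiniteRank G ∧ IsHilbertSchmidt G ∧
      opError T (inclusion hHZ) G < representationBias T (inclusion hHZ) + δ) ∧
    ((∀ δ : ℝ, 0 < δ → ∃ G : HX →L[ℝ] HZ, IsFiniteRank G ∧ IsHilbertSchmidt G ∧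
      opError T (inclusion hHZ) G < δ) ↔ representationBias T (inclusion hHZ) = 0) ∧
    (IsC0Universal HX → IsC0Universal HU → representationBias T (inclusion hHZ) = 0) := by
  have : CompactSpace X := isCompact_iff_compactSpace.1 hX
  have : CompactSpace U := isCompact_iff_compactSpace.1 hU
  have happrox : ∀ δ : ℝ, 0 < δ → ∃ G : HX →L[ℝ] HZ, IsFiniteRank G ∧ IsHilbertSchmidt G ∧
      opError T (inclusion hHZ) G < representationBias T (inclusion hHZ) + δ := fun δ hδ => by
    obtain ⟨G, hfin, hlt⟩ := exists_isFiniteRank_opError_lt T (inclusion hHZ)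
      (fun ε hε => hT ▸ exists_norm_comp_inclusion_sub_le hHX _ hε) hδ
    exact ⟨G, hfin, hfin.isHilbertSchmidt, hlt⟩
  refine ⟨happrox, ⟨fun h => ?_, fun h => ?_⟩, fun hHXu hHUu => ?_⟩
  · refine le_antisymm (le_of_forall_pos_lt_add fun δ hδ => ?_) (norm_nonneg _)
    obtain ⟨G, -, -, hlt⟩ := h δ hδ
    rw [zero_add]
    exact (representationBias_le_opError T (inclusion hHZ) G).trans_lt hlt
  · simpa only [h, zero_add] using happrox
  · rw [representationBias, norm_eq_zero]
    ext1 h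
    let F : C(X × U, ℝ) := ⟨fun z => h (f z), (hHX.continuous_apply h).comp hf⟩
    -- `T h` is the class of the continuous function `h ∘ f`.
    have hTh : T h = ContinuousMap.toLp 2 ν ℝ F := by
      refine Lp.ext ?_
      have h1 := koopman_toLp hf.measurable hG (hHX.memLp h)
      rw [← inclusion_apply] at h1
      rw [hT]
      exact h1.trans (ContinuousMap.coeFn_toLp (𝕜 := ℝ) (p := 2) ν F).symm
    have hmem : T h ∈
        (LinearMap.range (inclusion hHZ : HZ →ₗ[ℝ] Lp ℝ 2 ν)).topologicalClosure := by
      rw [hTh]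
      exact inclusion_mem_closure_range hHZ (hZ.dense_continuousMembers hHZ hHXu hHUu F)
    have hfix : rangeProjector (inclusion hHZ) (T h) = T h :=
      Submodule.starProjection_eq_self_iff.2 hmem
    simp [hfix]
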